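/- A subset $X$ of a group $G$ is called elementary algebraic if $X=\{x\in G: x^{\varepsilon_1}a_1x^{\varepsilon_2}a_2\cdots x^{\varepsilon_n}a_n=1\}$ for some integer $n>0$, $a_1,\dots,a_n\in G$ and $\varepsilon_1,\dots,\varepsilon_n\in\{-1,1\}$; it is algebraic if it is an intersection of finite unions of elementary algebraic sets; it is unconditionally closed if it is closed in every Hausdorff group topology on $G$. A Hausdorff group topology $\mathcal T$ on $G$ is precompact if $(G,\mathcal T)$ is topologically isomorphic to a subgroup of a compact Hausdorff group. The Zariski topology $\mathfrak Z_G$ is the topology whose closed sets are the algebraic subsets of $G$. The Markov topology $\mathfrak M_G$ and the precompact Markov topology $\mathfrak P_G$ are the infima, in the lattice of all topologies on $G$ ordered by inclusion, of all Hausdorff group topologies on $G$ and of all precompact Hausdorff group topologies on $G$, respectively. **Theorem.** Let $G$ be an abelian group. Then $\mathfrak Z_G=\mathfrak M_G=\mathfrak P_G$. Moreover, writing $G$ additively and $G[n]=\{x\in G: nx=0\}$, the following conditions are equivalent for every subset $X$ of $G$: (a) $X$ is algebraic; (b) $X$ is a (possibly empty) finite union of cosets $a+G[n]$ with $a\in G$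 and $n\in\mathbb N=\{0,1,2,\dots\}$; (c) $X$ is unconditionally closed; (d) $X$ is closed in every precompact Hausdorff group topology on $G$. -/

import Mathlib

open scoped Pointwise Topology

namespace MarkovZariski

universe u

/-- A subset `X` of a (not necessarily commutative, additively written) group `G` is *elementary
algebraic* if it is the solution set of one equation
`ε₁ x + a₁ + ε₂ x + a₂ + ⋯ + εₙ x + aₙ = 0` with `n > 0`, `aᵢ ∈ G` and `εᵢ ∈ {-1, 1}`. -/
def IsElementaryAlgebraic {G : Type u} [AddGroup G] (X : Set G) : Prop :=
  ∃ (n : ℕ) (a : Fin n → G) (ε : Fin n → ℤ), 0 < n ∧ (∀ i, ε i = -1 ∨ ε i = 1) ∧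
    X = {x : G | (List.ofFn fun i => ε i • x + a i).sum = 0}

/-- `X` is a union of finitely many elementary algebraic sets. -/
def IsFiniteUnionOfElementary {G : Type u} [AddGroup G] (X : Set G) : Prop :=
  ∃ 𝓔 : Set (Set G), 𝓔.Finite ∧ (∀ E ∈ 𝓔, IsElementaryAlgebraic E) ∧ X = ⋃₀ 𝓔

/-- `X` is *algebraic* if it is an intersection of finite unions of elementary algebraic sets. -/
def IsAlgebraicSet {G : Type u} [AddGroup G] (X : Set G) : Prop :=
  ∃ 𝓕 : Set (Set G), (∀ F ∈ 𝓕, IsFiniteUnionOfElementary F) ∧ X = ⋂₀ 𝓕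

theorem IsFiniteUnionOfElementary.union {G : Type u} [AddGroup G] {X Y : Set G}
    (hX : IsFiniteUnionOfElementary X) (hY : IsFiniteUnionOfElementary Y) :
    IsFiniteUnionOfElementary (X ∪ Y) := by
  obtain ⟨A, hA, hA', rfl⟩ := hX
  obtain ⟨B, hB, hB', rfl⟩ := hY
  refine ⟨A ∪ B, hA.union hB, ?_, (Set.sUnion_union A B).symm⟩
  rintro E (hE | hE)
  · exact hA' E hE
  · exact hB' E hE

theorem isAlgebraicSet_empty {G : Type u} [AddGroup G] : IsAlgebraicSet (∅ : Set G) :=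
  ⟨{∅}, by
    rintro F rfl
    exact ⟨∅, Set.finite_empty, by simp, by simp⟩, by simp⟩

theorem IsAlgebraicSet.sInter {G : Type u} [AddGroup G] {A : Set (Set G)}
    (hA : ∀ X ∈ A, IsAlgebraicSet X) : IsAlgebraicSet (⋂₀ A) := by
  refine ⟨{F | IsFiniteUnionOfElementary F ∧ ⋂₀ A ⊆ F}, fun F hF => hF.1,
    Set.Subset.antisymm (Set.subset_sInter fun F hF => hF.2) ?_⟩
  refine Set.subset_sInter fun X hX => ?_
  obtain ⟨𝓕, h𝓕, hX'⟩ := hA X hX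
  intro x hx
  rw [hX']
  intro F hF
  refine hx F ⟨h𝓕 F hF, ?_⟩
  exact (Set.sInter_subset_of_mem hX).trans (hX' ▸ Set.sInter_subset_of_mem hF)

theorem IsAlgebraicSet.union {G : Type u} [AddGroup G] {X Y : Set G}
    (hX : IsAlgebraicSet X) (hY : IsAlgebraicSet Y) : IsAlgebraicSet (X ∪ Y) := by
  obtain ⟨A, hA, rfl⟩ := hX
  obtain ⟨B, hB, rfl⟩ := hY
  refine ⟨{F | ∃ P ∈ A, ∃ Q ∈ B, F = P ∪ Q}, ?_, ?_⟩
  · rintro F ⟨P, hP, Q, hQ, rfl⟩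
    exact (hA P hP).union (hB Q hQ)
  · refine Set.Subset.antisymm ?_ ?_
    · rintro x hx F ⟨P, hP, Q, hQ, rfl⟩
      exact hx.imp (fun h => h P hP) (fun h => h Q hQ)
    · intro x hx
      by_contra hcon
      rw [Set.mem_union, not_or] at hcon
      obtain ⟨h1, h2⟩ := hcon
      simp only [Set.mem_sInter, not_forall] at h1 h2
      obtain ⟨P, hP, hxP⟩ := h1
      obtain ⟨Q, hQ, hxQ⟩ := h2
      exact (hx (P ∪ Q) ⟨P, hP, Q, hQ, rfl⟩).elim hxP hxQ

/-- The *Zariski topology* of a group: its closed sets are exactly the algebraic sets. -/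
def zariskiTopology (G : Type u) [AddGroup G] : TopologicalSpace G :=
  TopologicalSpace.ofClosed {X : Set G | IsAlgebraicSet X} isAlgebraicSet_empty
    (fun _ hA => IsAlgebraicSet.sInter fun _ hX => hA hX) (fun _ hX _ hY => hX.union hY)

/-- `T` is a Hausdorff group topology on `G`. -/
def IsHausdorffGroupTopology {G : Type u} [AddGroup G] (T : TopologicalSpace G) : Prop :=
  IsTopologicalAddGroup G ∧ T2Space G

/-- `T` is a *precompact* Hausdorff group topology on `G`: a Hausdorff group topology for which
`(G, T)` is topologically isomorphic to a subgroup of a compact Hausdorff group. (Such a compact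
group can always be taken in the universe of `G`: replace it by the closure of the image of `G`,
which is a completion of `G`.) -/
def IsPrecompactHausdorffGroupTopology {G : Type u} [AddGroup G] (T : TopologicalSpace G) : Prop :=
  IsHausdorffGroupTopology T ∧
    ∃ (K : Type u) (_ : AddGroup K) (_ : TopologicalSpace K),
      IsTopologicalAddGroup K ∧ CompactSpace K ∧ T2Space K ∧
        ∃ f : G →+ K, Topology.IsEmbedding f

/-- `X` is *unconditionally closed*: closed in every Hausdorff group topology on `G`. -/
def IsUnconditionallyClosed {G : Type u} [AddGroup G] (X : Set G) : Prop :=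
  ∀ T : TopologicalSpace G, IsHausdorffGroupTopology T → IsClosed[T] X

/-- `X` is closed in every precompact Hausdorff group topology on `G`. -/
def IsClosedInEveryPrecompact {G : Type u} [AddGroup G] (X : Set G) : Prop :=
  ∀ T : TopologicalSpace G, IsPrecompactHausdorffGroupTopology T → IsClosed[T] X

/-- The *Markov topology*: the infimum (with respect to inclusion of families of open sets) of all
Hausdorff group topologies on `G`. Mathlib orders topologies by reverse inclusion, so that this
infimum is Mathlib's `sSup`: a set is open iff it is open in each of them. -/
def markovTopology (G : Type u) [AddGroup G] : TopologicalSpace G :=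
  sSup {T : TopologicalSpace G | IsHausdorffGroupTopology T}

/-- The *precompact Markov topology*: the infimum (with respect to inclusion of families of open
sets) of all precompact Hausdorff group topologies on `G`. -/
def precompactMarkovTopology (G : Type u) [AddGroup G] : TopologicalSpace G :=
  sSup {T : TopologicalSpace G | IsPrecompactHausdorffGroupTopology T}

/-- `X` is a union of finitely many cosets `a + G[n]` with `a ∈ G` and `n ∈ ℕ` (`n = 0` allowed),
where `G[n] = {x | n x = 0}`. -/
def IsFiniteUnionOfTorsionCosets {G : Type u} [AddCommGroup G] (X : Set G) : Prop :=
  ∃ S : Set (G × ℕ), S.Finite ∧ X = ⋃ p ∈ S, p.1 +ᵥ {x : G | p.2 • x = 0}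

end MarkovZariski

/-!
An elementary algebraic set is closed in every Hausdorff group topology because it is the zero set
of a continuous function, and a coset `a + G[n]` is elementary algebraic, being the solution set of
`n x = n a`. Everything therefore reduces to one implication: a set `X` that is closed in every
precompact Hausdorff group topology is a finite union of cosets of subgroups `G[n]`.

This is proved by Noetherian induction: `X ∩ (a + G[n])` is such a union for every `n`,
assuming it for the proper divisors of `n` (`IsClosedInEveryPrecompact.inter_torsionCoset`). Otherwise the coset
contains a point `z ∉ X`, and no finite number of cosets of the groups `G[d]`, with `d` a proper
divisor of `n`, covers `X ∩ (z + G[n])`. This yields a sequence `s` in `(X - z) ∩ G[n]` such that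
`k ↦ d • s k` is finite-to-one whenever `n ∤ d`. For such a sequence there is a precompact Hausdorff
group topology in which `0` lies in the closure of `s`
(`exists_precompact_zero_mem_closure`), so `z` lies in the closure of `X`, a contradiction.

To find the topology it is enough to work on the countable subgroup `H` generated by `s`, since the
characters of `H` extend to `G`, and the characters vanishing on `H` separate the points
outside `H` from `0`. On `H`, a Baire category argument (`exists_separating_characters`) in the
compact space of sequences of characters gives a point-separating sequence that is arbitrarily small, in
finitely many coordinates at a time, along `s`. The required density is `exists_character_near`:
every character can be perturbed, up to `δ` on a given finite set, so as to be small at some `s k`.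
-/

namespace MarkovZariski

/-! ### Extending and perturbing characters -/

/-- Homomorphisms into a divisible group factor through any homomorphism with a smaller kernel. -/
theorem exists_comp_eq_of_ker_le {M N Q : Type*} [AddCommGroup M] [AddCommGroup N]
    [AddCommGroup Q] [DivisibleBy Q ℤ] (f : M →+ N) (g : M →+ Q) (h : f.ker ≤ g.ker) :
    ∃ k : N →+ Q, k.comp f = g := by
  obtain ⟨k, hk⟩ := (Module.Baer.of_divisible Q).extension_property_addMonoidHom
    (QuotientAddGroup.kerLift f) (QuotientAddGroup.kerLift_injective f)
    (QuotientAddGroup.lift f.ker g h)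
  refine ⟨k, AddMonoidHom.ext fun x => ?_⟩
  simpa using DFunLike.congr_fun hk (QuotientAddGroup.mk x)

theorem exists_hom_apply_eq {N Q : Type*} [AddCommGroup N] [AddCommGroup Q] [DivisibleBy Q ℤ]
    (x : N) (w : Q) (h : addOrderOf x • w = 0) : ∃ k : N →+ Q, k x = w := by
  obtain ⟨k, hk⟩ := exists_comp_eq_of_ker_le (zmultiplesHom N x) (zmultiplesHom Q w) (by
    intro m hm
    rw [AddMonoidHom.mem_ker, zmultiplesHom_apply] at hm ⊢
    obtain ⟨c, rfl⟩ := addOrderOf_dvd_iff_zsmul_eq_zero.2 hm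
    rw [mul_comm, mul_smul, natCast_zsmul, h, smul_zero])
  exact ⟨k, by simpa using DFunLike.congr_fun hk 1⟩

/-- A homomorphism `χ` into a divisible group can be changed off the subgroup `A` so as to take at
`x` any value `y` compatible with `χ` on `A`: if `o` is the order of `x` modulo `A`, with `o = 0`
when the order is infinite, the only constraint is `o y = χ (o x)`. -/
theorem exists_hom_eqOn_apply_eq {N Q : Type*} [AddCommGroup N] [AddCommGroup Q] [DivisibleBy Q ℤ]
    (A : AddSubgroup N) (χ : N →+ Q) (x : N) (y : Q)
    (h : addOrderOf (x : N ⧸ A) • y = χ (addOrderOf (x : N ⧸ A) • x)) :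
    ∃ χ' : N →+ Q, (∀ a ∈ A, χ' a = χ a) ∧ χ' x = y := by
  obtain ⟨ξ, hξ⟩ := exists_hom_apply_eq (x : N ⧸ A) (y - χ x)
    (by rw [smul_sub, h, map_nsmul, sub_self])
  refine ⟨χ + ξ.comp (QuotientAddGroup.mk' A), fun a ha => ?_, ?_⟩
  · simp [(QuotientAddGroup.eq_zero_iff a).2 ha]
  · simp [hξ]

theorem norm_unitAddCircle_coe_le_abs (x : ℝ) : ‖(x : UnitAddCircle)‖ ≤ |x| := by
  rw [UnitAddCircle.norm_eq]
  simpa using round_le x 0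

theorem exists_nsmul_eq_norm_le (n : ℕ) (hn : 0 < n) (z : UnitAddCircle) :
    ∃ y : UnitAddCircle, n • y = z ∧ ‖y‖ ≤ 1 / n := by
  obtain ⟨r, ⟨h0, h1⟩, rfl⟩ : ∃ r ∈ Set.Ico (0 : ℝ) 1, (r : UnitAddCircle) = z := by
    have := (AddCircle.coe_image_Ico_eq (1 : ℝ) 0).symm ▸ Set.mem_univ z
    simpa using this
  have hn' : (0 : ℝ) < n := by exact_mod_cast hn
  refine ⟨((r / n : ℝ) : UnitAddCircle), ?_, (norm_unitAddCircle_coe_le_abs _).trans ?_⟩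
  · rw [← AddCircle.coe_nsmul, nsmul_eq_mul, mul_div_cancel₀ _ hn'.ne']
  · rw [abs_of_nonneg (by positivity)]
    gcongr

theorem finite_setOf_nsmul_eq_zero (A : Type*) [AddCommGroup A] [Module.Finite ℤ A] {e : ℕ}
    (he : e ≠ 0) : {a : A | e • a = 0}.Finite := by
  have : Finite (nsmulAddMonoidHom (α := A) e).ker.toIntSubmodule := by
    refine Module.finite_of_fg_torsion _ fun x => ?_
    refine ⟨⟨(e : ℤ), mem_nonZeroDivisors_of_ne_zero (by exact_mod_cast he)⟩, Subtype.ext ?_⟩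
    have hx : e • (x : A) = 0 := x.2
    exact (natCast_zsmul (x : A) e).trans hx
  exact this

/-- Modulo its finite torsion subgroup, `A` is `ℤʳ`, so one of the `r` coordinates works. -/
theorem exists_hom_int_infinite_image (A : Type*) [AddCommGroup A] [Module.Finite ℤ A] {Y : Set A}
    (hY : Y.Infinite) : ∃ ψ : A →+ ℤ, (ψ '' Y).Infinite := by
  by_contra! hcon
  apply hY
  let t := Submodule.torsion ℤ A
  have ht : Finite t := Module.finite_of_fg_torsion t (Submodule.torsion_isTorsion)
  let b := Module.Free.chooseBasis ℤ (A ⧸ t)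
  let g : A →+ (Module.Free.ChooseBasisIndex ℤ (A ⧸ t) → ℤ) :=
    (b.equivFun.toLinearMap.comp t.mkQ).toAddMonoidHom
  have hfin : (g '' Y).Finite := by
    refine (Set.Finite.pi' fun i => hcon ((Pi.evalAddMonoidHom _ i).comp g)).subset ?_
    rintro _ ⟨y, hy, rfl⟩ i
    exact ⟨y, hy, rfl⟩
  refine Set.Finite.of_finite_fibers g hfin ?_
  rintro _ ⟨y, hy, rfl⟩
  refine ((Set.toFinite (t : Set A)).image (y + ·)).subset ?_
  rintro z ⟨-, hz⟩
  refine ⟨z - y, ?_, by simp⟩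
  have : t.mkQ z = t.mkQ y := b.equivFun.injective hz
  rwa [Submodule.mkQ_apply, Submodule.mkQ_apply, Submodule.Quotient.eq] at this

/-- The perturbation step. Any character can be moved by less than `δ` on the finite set `F` so that
it becomes small at some `s k`; moreover `k` does not depend on the character, so that several
characters can be treated at once.

Let `A` be the subgroup generated by `F`. If `s k` has infinite or large order modulo `A`, or order
exactly `e`, then `χ` can be left unchanged on `A` and a small value at `s k` is available. For
`e > 0` one of the last alternatives must occur, as the torsion of `A` is finite. For `e = 0` the
remaining case is that a fixed multiple of every `s k` lies in `A`; then some `Ψ : H →+ ℝ` is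
unbounded on the sequence, and adding a small real multiple of `Ψ` to `χ` annihilates some `s k`. -/
theorem exists_character_near {H : Type*} [AddCommGroup H] (e : ℕ) (s : ℕ → H)
    (hs : ∀ k, e • s k = 0) (hinj : ∀ d, ¬ e ∣ d → ∀ x, {k | d • s k = x}.Finite)
    (F : Finset H) {δ ε : ℝ} (hδ : 0 < δ) (hε : 0 < ε) :
    ∃ k, ∀ χ : H →+ UnitAddCircle, ∃ χ' : H →+ UnitAddCircle,
      (∀ h ∈ F, ‖χ' h - χ h‖ < δ) ∧ ‖χ' (s k)‖ < ε := by
  let A : AddSubgroup H := AddSubgroup.closure F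
  have hFA : ∀ h ∈ F, h ∈ A := fun h hh => AddSubgroup.subset_closure hh
  have : Module.Finite ℤ A := by
    rw [Module.Finite.iff_addGroup_fg]
    infer_instance
  by_cases hroot : ∃ k, ∀ χ : H →+ UnitAddCircle, ∃ y : UnitAddCircle, ‖y‖ < ε ∧
      addOrderOf (s k : H ⧸ A) • y = χ (addOrderOf (s k : H ⧸ A) • s k)
  · obtain ⟨k, hk⟩ := hroot
    refine ⟨k, fun χ => ?_⟩
    obtain ⟨y, hy, hy'⟩ := hk χ
    obtain ⟨χ', h1, h2⟩ := exists_hom_eqOn_apply_eq A χ (s k) y hy'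
    exact ⟨χ', fun h hh => by rwa [h1 h (hFA h hh), sub_self, norm_zero], by rwa [h2]⟩
  push Not at hroot
  rcases Nat.eq_zero_or_pos e with rfl | he
  · obtain ⟨N, hN⟩ := exists_nat_one_div_lt hε
    -- The order of every `s k` modulo `A` is positive and at most `N + 1`, since otherwise an
    -- `o`-th root of norm at most `1 / o` would be available.
    have hA : ∀ k, (N + 1).factorial • s k ∈ A := by
      intro k
      rw [← QuotientAddGroup.eq_zero_iff, QuotientAddGroup.mk_nsmul,
        ← addOrderOf_dvd_iff_nsmul_eq_zero]
      have h0 : 0 < addOrderOf (s k : H ⧸ A) := by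
        by_contra! h0
        obtain ⟨χ, hχ⟩ := hroot k
        refine hχ 0 (by simpa) (by simp [Nat.le_zero.1 h0])
      refine Nat.dvd_factorial h0 ?_
      by_contra! hlt
      obtain ⟨χ, hχ⟩ := hroot k
      obtain ⟨y, hy, hy'⟩ :=
        exists_nsmul_eq_norm_le _ h0 (χ (addOrderOf (s k : H ⧸ A) • s k))
      refine hχ y (hy'.trans_lt (lt_of_le_of_lt ?_ hN)) hy
      have : ((N : ℝ) + 1) ≤ addOrderOf (s k : H ⧸ A) := by exact_mod_cast hlt.le
      gcongr
    have hinf : (Set.range fun k => (⟨_, hA k⟩ : A)).Infinite := by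
      intro hfin
      refine Set.infinite_univ (α := ℕ) (Set.Finite.of_finite_fibers
        (fun k => (⟨_, hA k⟩ : A)) (by simpa using hfin) fun x _ => ?_)
      refine (hinj (N + 1).factorial (by simp [Nat.factorial_ne_zero]) x).subset ?_
      rintro k ⟨-, hk⟩
      exact congrArg Subtype.val hk
    obtain ⟨ψ, hψ⟩ := exists_hom_int_infinite_image A hinf
    obtain ⟨Ψ, hΨ⟩ := (Module.Baer.of_divisible ℝ).extension_property_addMonoidHom
      A.subtype A.subtype_injective ((Int.castAddHom ℝ).comp ψ)
    obtain ⟨M, hM0, hM⟩ : ∃ M : ℝ, 0 < M ∧ ∀ h ∈ F, |Ψ h| ≤ M :=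
      ⟨1 + ∑ h ∈ F, |Ψ h|, by positivity, fun h hh =>
        (Finset.single_le_sum (fun i _ => abs_nonneg (Ψ i)) hh).trans (by simp)⟩
    obtain ⟨k, hk⟩ : ∃ k, 2 * M / δ ≤ |Ψ (s k)| := by
      by_contra! hlt
      apply hψ
      let B : ℝ := (N + 1).factorial * (2 * M / δ)
      refine (Set.finite_Icc (⌊-B⌋) ⌈B⌉).subset ?_
      rintro _ ⟨_, ⟨k, rfl⟩, rfl⟩
      have h1 : (ψ ⟨_, hA k⟩ : ℝ) = (N + 1).factorial * Ψ (s k) := by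
        have := DFunLike.congr_fun hΨ (⟨_, hA k⟩ : A)
        simpa using this.symm
      have h2 : |(ψ ⟨_, hA k⟩ : ℝ)| ≤ B := by
        rw [h1, abs_mul, Nat.abs_cast]
        exact mul_le_mul_of_nonneg_left (hlt k).le (by positivity)
      rw [abs_le] at h2
      constructor
      · exact_mod_cast (Int.floor_le _).trans h2.1
      · exact_mod_cast h2.2.trans (Int.le_ceil _)
    refine ⟨k, fun χ => ?_⟩
    -- Adding `(r / Ψ (s k)) • Ψ` cancels `χ (s k)`; the factor is at most `δ / (2 * M)`.
    obtain ⟨r, ⟨hr0, hr1⟩, hr⟩ : ∃ r ∈ Set.Ico (0 : ℝ) 1, (r : UnitAddCircle) = - χ (s k) := by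
      have := (AddCircle.coe_image_Ico_eq (1 : ℝ) 0).symm ▸ Set.mem_univ (- χ (s k))
      simpa using this
    have hpos : 0 < |Ψ (s k)| := lt_of_lt_of_le (by positivity) hk
    let θ : H →+ UnitAddCircle :=
      (QuotientAddGroup.mk' _).comp ((AddMonoidHom.mulLeft (r / Ψ (s k))).comp Ψ)
    have hθ : ∀ h, θ h = ((r / Ψ (s k) * Ψ h : ℝ) : UnitAddCircle) := fun h => rfl
    refine ⟨χ + θ, fun h hh => ?_, ?_⟩
    · rw [AddMonoidHom.add_apply, add_sub_cancel_left, hθ]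
      refine (norm_unitAddCircle_coe_le_abs _).trans_lt ?_
      rw [abs_mul, abs_div, abs_of_nonneg hr0, div_mul_eq_mul_div, div_lt_iff₀ hpos]
      rw [div_le_iff₀ hδ] at hk
      nlinarith [hM h hh, abs_nonneg (Ψ h)]
    · rw [AddMonoidHom.add_apply, hθ, div_mul_cancel₀ _ (abs_pos.1 hpos), hr, add_neg_cancel,
        norm_zero]
      exact hε
  · exfalso
    have hbad : ∀ k, ∃ d ∈ Finset.Ioo 0 e, d • s k ∈ A := by
      intro k
      have hdvd : addOrderOf (s k : H ⧸ A) ∣ e := by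
        rw [addOrderOf_dvd_iff_nsmul_eq_zero, ← QuotientAddGroup.mk_nsmul, hs,
          QuotientAddGroup.mk_zero]
      refine ⟨addOrderOf (s k : H ⧸ A), Finset.mem_Ioo.2 ⟨Nat.pos_of_dvd_of_pos hdvd he,
        lt_of_le_of_ne (Nat.le_of_dvd he hdvd) fun heq => ?_⟩, ?_⟩
      · obtain ⟨χ, hχ⟩ := hroot k
        exact hχ 0 (by simpa) (by rw [heq, hs, map_zero, smul_zero])
      · rw [← QuotientAddGroup.eq_zero_iff, QuotientAddGroup.mk_nsmul, addOrderOf_nsmul_eq_zero]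
    -- A multiple `d • s k` lying in `A` is one of the finitely many `e`-torsion elements of `A`.
    have hfin : (⋃ d ∈ Finset.Ioo 0 e, ⋃ a ∈ {a : A | e • a = 0}, {k | d • s k = a}).Finite := by
      refine (Finset.finite_toSet _).biUnion fun d hd => ?_
      refine (finite_setOf_nsmul_eq_zero A he.ne').biUnion fun a _ => hinj d ?_ a
      obtain ⟨h1, h2⟩ := Finset.mem_Ioo.1 hd
      exact Nat.not_dvd_of_pos_of_lt h1 h2
    refine Set.infinite_univ (α := ℕ) (hfin.subset fun k _ => ?_)
    obtain ⟨d, hd, hdA⟩ := hbad k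
    simp only [Set.mem_iUnion]
    refine ⟨d, hd, ⟨_, hdA⟩, ?_, rfl⟩
    exact Subtype.ext (by simp [smul_comm e d, hs])


/-! ### Precompact topologies in which a sequence accumulates at zero -/

theorem exists_character_apply_ne_zero {H : Type*} [AddCommGroup H] {h : H} (hh : h ≠ 0) :
    ∃ χ : H →+ UnitAddCircle, χ h ≠ 0 := by
  obtain ⟨n, hn0, hn1, hn⟩ : ∃ n : ℕ, 0 < n ∧ n ≠ 1 ∧ n ∣ addOrderOf h := by
    rcases Nat.eq_zero_or_pos (addOrderOf h) with h0 | h0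
    · exact ⟨2, by simp, by simp, by simp [h0]⟩
    · exact ⟨_, h0, by rwa [Ne, AddMonoid.addOrderOf_eq_one_iff], dvd_rfl⟩
  have hw : addOrderOf (((1 : ℝ) / n : ℝ) : UnitAddCircle) = n :=
    AddCircle.addOrderOf_period_div hn0
  obtain ⟨χ, hχ⟩ := exists_hom_apply_eq h (((1 : ℝ) / n : ℝ) : UnitAddCircle)
    (addOrderOf_dvd_iff_nsmul_eq_zero.1 (by rwa [hw]))
  refine ⟨χ, fun h0 => hn1 ?_⟩
  rw [← hw, ← hχ, h0, addOrderOf_zero]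

/-- In the compact space of sequences of characters of a countable group, separating a given nonzero
point and being small at some term of `s` are dense open conditions, so that Baire's theorem
applies. -/
theorem exists_separating_characters {H : Type*} [AddCommGroup H] [Countable H] (e : ℕ) (s : ℕ → H)
    (hs : ∀ k, e • s k = 0) (hinj : ∀ d, ¬ e ∣ d → ∀ x, {k | d • s k = x}.Finite) :
    ∃ φ : ℕ → H →+ UnitAddCircle, (∀ h, h ≠ 0 → ∃ j, φ j h ≠ 0) ∧
      ∀ m : ℕ, ∃ k, ∀ j < m, ‖φ j (s k)‖ < 1 / ((m : ℝ) + 1) := by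
  classical
  -- Sequences of characters, as a closed subset of a product of circles.
  let C : Set (ℕ × H → UnitAddCircle) := {f | ∀ j a b, f (j, a + b) = f (j, a) + f (j, b)}
  have hC : IsClosed C := by
    simp only [C, Set.ofPred_forall]
    refine isClosed_iInter fun j => isClosed_iInter fun a => isClosed_iInter fun b =>
      isClosed_eq (by fun_prop) (by fun_prop)
  have : CompactSpace C := isCompact_iff_compactSpace.1 hC.isCompact
  have hcont (p : ℕ × H) : Continuous fun f : C => f.1 p :=
    (continuous_apply p).comp continuous_subtype_val
  let fam (f : C) (j : ℕ) : H →+ UnitAddCircle := AddMonoidHom.mk' (fun a => f.1 (j, a)) (f.2 j)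
  let ofFam (φ : ℕ → H →+ UnitAddCircle) : C := ⟨fun p => φ p.1 p.2, fun j a b => map_add _ _ _⟩
  -- Density may be tested on finitely many coordinates at finitely many points.
  have hdense : ∀ U : Set C, (∀ (φ : ℕ → H →+ UnitAddCircle) (I : Finset (ℕ × H)) (δ : ℝ), 0 < δ →
      ∃ φ', ofFam φ' ∈ U ∧ ∀ p ∈ I, ‖φ' p.1 p.2 - φ p.1 p.2‖ < δ) → Dense U := by
    intro U hU f
    rw [mem_closure_iff_nhds]
    intro V hV
    rw [nhds_subtype_eq_comap, nhds_pi, Filter.mem_comap] at hV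
    obtain ⟨W, hW, hWV⟩ := hV
    rw [Filter.mem_pi'] at hW
    obtain ⟨I, t, ht, htW⟩ := hW
    have hball : ∀ p, ∃ δ > 0, Metric.ball (f.1 p) δ ⊆ t p := fun p => Metric.mem_nhds_iff.1 (ht p)
    choose δ hδ hδt using hball
    obtain ⟨η, hη, hηI⟩ : ∃ η > 0, ∀ p ∈ I, η ≤ δ p := by
      rcases I.eq_empty_or_nonempty with rfl | hI
      · exact ⟨1, one_pos, by simp⟩
      · exact ⟨I.inf' hI δ, (Finset.lt_inf'_iff hI).2 fun p _ => hδ p, fun p hp =>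
          Finset.inf'_le _ hp⟩
    obtain ⟨φ', hφU, hφ'⟩ := hU (fam f) I η hη
    refine ⟨ofFam φ', hWV (htW fun p hp => hδt p ?_), hφU⟩
    rw [mem_ball_iff_norm]
    exact (hφ' p hp).trans_le (hηI p hp)
  let U : H ⊕ ℕ → Set C := Sum.elim (fun h => {f | h ≠ 0 → ∃ j, f.1 (j, h) ≠ 0})
    (fun m => {f | ∃ k, ∀ j < m, ‖f.1 (j, s k)‖ < 1 / ((m : ℝ) + 1)})
  have hUo : ∀ i, IsOpen (U i) := by
    rintro (h | m)
    · simp only [U, Sum.elim_inl, Set.ofPred_forall, Set.ofPred_exists]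
      refine isOpen_iff_mem_nhds.2 ?_
      by_cases hh : h = 0
      · simp [hh]
      · simp only [ne_eq, hh, not_false_eq_true, Set.iInter_true]
        exact isOpen_iff_mem_nhds.1 (isOpen_iUnion fun j =>
          isOpen_ne_fun (hcont _) continuous_const)
    · simp only [U, Sum.elim_inr, Set.ofPred_exists]
      refine isOpen_iUnion fun k => ?_
      simp only [Set.ofPred_forall]
      exact (Set.finite_lt_nat m).isOpen_biInter fun j _ =>
        isOpen_lt (hcont _).norm continuous_const
  have hUd : ∀ i, Dense (U i) := by
    rintro (h | m) <;> refine hdense _ fun φ I δ hδ => ?_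
    · by_cases hh : h = 0
      · exact ⟨φ, fun h0 => (h0 hh).elim, fun p _ => by simpa⟩
      · obtain ⟨χ, hχ⟩ := exists_character_apply_ne_zero hh
        obtain ⟨j, hj⟩ := Infinite.exists_notMem_finset (I.image Prod.fst)
        refine ⟨Function.update φ j χ, fun _ => ⟨j, by simpa [ofFam] using hχ⟩, fun p hp => ?_⟩
        have : p.1 ≠ j := fun h => hj (Finset.mem_image.2 ⟨p, hp, h⟩)
        simpa [Function.update_of_ne this]
    · obtain ⟨k, hk⟩ := exists_character_near e s hs hinj (I.image Prod.snd) hδ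
        (Nat.one_div_pos_of_nat (n := m) (α := ℝ))
      choose φ' h1 h2 using fun j => hk (φ j)
      exact ⟨φ', ⟨k, fun j _ => h2 j⟩, fun p hp => h1 p.1 p.2 (Finset.mem_image_of_mem _ hp)⟩
  have : Nonempty C := ⟨ofFam 0⟩
  obtain ⟨f, hf⟩ := (dense_iInter_of_isOpen hUo hUd).nonempty
  rw [Set.mem_iInter] at hf
  exact ⟨fam f, fun h => hf (Sum.inl h), fun m => hf (Sum.inr m)⟩

/-- The topology is induced by extensions to `G` of countably many characters of the countable
subgroup `H` generated by the sequence, together with all characters of `G ⧸ H`. The latter vanish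
on the sequence and therefore do not affect whether it accumulates at `0`; all together
separate points. -/
theorem exists_precompact_zero_mem_closure {G : Type*} [AddCommGroup G] (e : ℕ) (s : ℕ → G)
    (hs : ∀ k, e • s k = 0) (hinj : ∀ d, ¬ e ∣ d → ∀ x, {k | d • s k = x}.Finite) :
    ∃ T : TopologicalSpace G, IsPrecompactHausdorffGroupTopology T ∧
      (0 : G) ∈ @closure G T (Set.range s) := by
  let H : AddSubgroup G := (Finsupp.linearCombination ℤ s).toAddMonoidHom.range
  have : Countable H :=
    (Set.countable_range (Finsupp.linearCombination ℤ s).toAddMonoidHom).to_subtype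
  have hsH : ∀ k, s k ∈ H := fun k => ⟨Finsupp.single k 1, by simp⟩
  obtain ⟨φ, hφ, hφs⟩ := exists_separating_characters e (fun k => (⟨s k, hsH k⟩ : H))
    (fun k => Subtype.ext (hs k)) fun d hd x => by
      simpa [Subtype.ext_iff] using hinj d hd x
  choose χ hχ using fun j =>
    (Module.Baer.of_divisible UnitAddCircle).extension_property_addMonoidHom H.subtype
      H.subtype_injective (φ j)
  replace hχ : ∀ j (h : H), χ j h = φ j h := fun j h => DFunLike.congr_fun (hχ j) h
  let Φ : G →+ (ℕ ⊕ (G ⧸ H →+ UnitAddCircle) → UnitAddCircle) :=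
    AddMonoidHom.pi (Sum.elim χ fun ξ => ξ.comp (QuotientAddGroup.mk' H))
  have hΦ : Function.Injective Φ := by
    rw [injective_iff_map_eq_zero]
    intro g hg
    have hgH : g ∈ H := by
      by_contra hgH
      obtain ⟨ξ, hξ⟩ := exists_character_apply_ne_zero
        (mt (QuotientAddGroup.eq_zero_iff (N := H) g).1 hgH)
      exact hξ (congrFun hg (Sum.inr ξ))
    by_contra h0
    obtain ⟨j, hj⟩ := hφ ⟨g, hgH⟩ (by simpa [Subtype.ext_iff] using h0)
    exact hj ((hχ j _).symm.trans (congrFun hg (Sum.inl j)))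
  let T : TopologicalSpace G := TopologicalSpace.induced Φ inferInstance
  have hemb : Topology.IsEmbedding Φ := ⟨⟨rfl⟩, hΦ⟩
  refine ⟨T, ⟨⟨topologicalAddGroup_induced Φ, hemb.t2Space⟩, _, inferInstance, inferInstance,
    inferInstance, inferInstance, inferInstance, Φ, hemb⟩, ?_⟩
  rw [closure_induced, mem_closure_iff_nhds]
  intro V hV
  rw [map_zero, nhds_pi, Filter.mem_pi'] at hV
  obtain ⟨I, t, ht, htV⟩ := hV
  have hball : ∀ p, ∃ δ > 0, Metric.ball (0 : UnitAddCircle) δ ⊆ t p :=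
    fun p => Metric.mem_nhds_iff.1 (ht p)
  choose δ hδ hδt using hball
  obtain ⟨m, hm⟩ : ∃ m : ℕ, ∀ j, Sum.inl j ∈ I → j < m ∧ 1 / ((m : ℝ) + 1) ≤ δ (Sum.inl j) := by
    have hev : ∀ᶠ m : ℕ in Filter.atTop, ∀ p ∈ I, ∀ j, p = Sum.inl j →
        j < m ∧ 1 / ((m : ℝ) + 1) ≤ δ p := by
      refine (Filter.eventually_all_finset I).2 ?_
      rintro (j | ξ) _
      · filter_upwards [Filter.eventually_gt_atTop j,
          tendsto_one_div_add_atTop_nhds_zero_nat.eventually_le_const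
          (hδ (Sum.inl j))] with m h1 h2 i hi
        obtain rfl := Sum.inl_injective hi
        exact ⟨h1, h2⟩
      · simp
    obtain ⟨m, hm⟩ := hev.exists
    exact ⟨m, fun j hj => hm _ hj j rfl⟩
  obtain ⟨k, hk⟩ := hφs m
  refine ⟨Φ (s k), htV ?_, s k, ⟨k, rfl⟩, rfl⟩
  rintro (j | ξ) hp
  · obtain ⟨h1, h2⟩ := hm j hp
    refine hδt _ (mem_ball_zero_iff.2 (lt_of_lt_of_le ?_ h2))
    have : Φ (s k) (Sum.inl j) = φ j ⟨s k, hsH k⟩ := hχ j ⟨s k, hsH k⟩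
    rw [this]
    exact hk j h1
  · have : Φ (s k) (Sum.inr ξ) = 0 := by
      change ξ (QuotientAddGroup.mk (s k)) = 0
      rw [(QuotientAddGroup.eq_zero_iff _).2 (hsH k), map_zero]
    rw [this]
    exact mem_of_mem_nhds (ht _)


/-! ### Algebraic sets and unions of torsion cosets -/

theorem mem_torsionCoset {G : Type*} [AddCommGroup G] {a x : G} {n : ℕ} :
    x ∈ a +ᵥ {x : G | n • x = 0} ↔ n • x = n • a := by
  rw [Set.mem_vadd_set_iff_neg_vadd_mem, Set.mem_ofPred_eq, vadd_eq_add, neg_add_eq_sub, smul_sub,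
    sub_eq_zero]

theorem isFiniteUnionOfTorsionCosets_biUnion {G ι : Type*} [AddCommGroup G] (I : Finset ι)
    {X : ι → Set G} (h : ∀ i ∈ I, IsFiniteUnionOfTorsionCosets (X i)) :
    IsFiniteUnionOfTorsionCosets (⋃ i ∈ I, X i) := by
  choose! S hS hX using h
  refine ⟨⋃ i ∈ I, S i, I.finite_toSet.biUnion hS, ?_⟩
  rw [Set.iUnion₂_congr hX]
  ext x
  simp only [Set.mem_iUnion, exists_prop]
  constructor
  · rintro ⟨i, hi, p, hp, hx⟩
    exact ⟨p, ⟨i, hi, hp⟩, hx⟩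
  · rintro ⟨p, ⟨i, hi, hp⟩, hx⟩
    exact ⟨i, hi, p, hp, hx⟩

/-- Noetherian induction on `n` along divisibility, with `n = 0` the largest element. -/
theorem IsClosedInEveryPrecompact.inter_torsionCoset {G : Type*} [AddCommGroup G] {X : Set G}
    (hX : IsClosedInEveryPrecompact X) (n : ℕ) :
    ∀ a : G, IsFiniteUnionOfTorsionCosets (X ∩ (a +ᵥ {x : G | n • x = 0})) := by
  classical
  induction n using (wellFounded_dvdNotUnit (α := ℕ)).induction with | _ n ih
  intro a
  by_contra hcon
  obtain ⟨z, hza, hzX⟩ : ∃ z, n • z = n • a ∧ z ∉ X := by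
    by_contra! hsub
    refine hcon ⟨{(a, n)}, Set.finite_singleton _, ?_⟩
    rw [Set.biUnion_singleton, Set.inter_eq_right]
    exact fun x hx => hsub x (mem_torsionCoset.1 hx)
  -- Translating by `z` gives a sequence in `X - z` whose first components lie in `G[n]`; the second
  -- components only record how many `d` have been taken care of.
  obtain ⟨f, hf, hfr⟩ := exists_seq_of_forall_finset_exists
    (fun p : G × ℕ => z + p.1 ∈ X ∧ n • p.1 = 0)
    (fun p q => p.2 < q.2 ∧ ∀ d ≤ q.2, ¬ n ∣ d → d • p.1 ≠ d • q.1) (by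
      intro S hS
      by_contra! hcov
      let I := S ×ˢ {d ∈ Finset.range (S.sup Prod.snd + 2) | ¬ n ∣ d}
      -- If no next term existed, finitely many smaller cosets would cover `X ∩ (a + G[n])`.
      have hun : X ∩ (a +ᵥ {x : G | n • x = 0}) =
          ⋃ i ∈ I, X ∩ ((z + i.1.1) +ᵥ {x : G | n.gcd i.2 • x = 0}) := by
        ext x
        simp only [Set.mem_iUnion, Set.mem_inter_iff, mem_torsionCoset, exists_prop]
        constructor
        · rintro ⟨hxX, hx⟩
          have hnx : n • (x - z) = 0 := by rw [smul_sub, hx, hza, sub_self]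
          obtain ⟨p, hp, hpr⟩ := hcov (x - z, S.sup Prod.snd + 1) ⟨by simpa, hnx⟩
          obtain ⟨d, hd, hnd, hdp⟩ := hpr (Nat.lt_succ_of_le (Finset.le_sup (f := Prod.snd) hp))
          refine ⟨(p, d), Finset.mem_product.2 ⟨hp, Finset.mem_filter.2
            ⟨Finset.mem_range.2 (Nat.lt_succ_of_le hd), hnd⟩⟩, hxX, ?_⟩
          have h1 : n • (x - z - p.1) = 0 := by rw [smul_sub, hnx, (hS p hp).2, sub_self]
          have h2 : d • (x - z - p.1) = 0 := by rw [smul_sub, hdp, sub_self]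
          have h3 : n.gcd d • (x - z - p.1) = 0 :=
            addOrderOf_dvd_iff_nsmul_eq_zero.1 (Nat.dvd_gcd
              (addOrderOf_dvd_iff_nsmul_eq_zero.2 h1) (addOrderOf_dvd_iff_nsmul_eq_zero.2 h2))
          rwa [sub_sub, smul_sub, sub_eq_zero] at h3
        · rintro ⟨i, hi, hxX, hx⟩
          obtain ⟨hp, -⟩ := Finset.mem_product.1 hi
          obtain ⟨c, hc⟩ := Nat.gcd_dvd_left n i.2
          refine ⟨hxX, ?_⟩
          have h1 : n • x = n • (z + i.1.1) := by
            rw [hc, mul_comm, mul_smul, hx, ← mul_smul]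
          rw [h1, smul_add, (hS _ hp).2, add_zero, hza]
      refine hcon (hun ▸ isFiniteUnionOfTorsionCosets_biUnion I fun i hi => ih _ ?_ _)
      obtain ⟨-, hd⟩ := Finset.mem_product.1 hi
      refine dvdNotUnit_of_dvd_of_not_dvd (Nat.gcd_dvd_left _ _) fun hdvd => ?_
      exact (Finset.mem_filter.1 hd).2 (hdvd.trans (Nat.gcd_dvd_right _ _)))
  have hmono : StrictMono fun k => (f k).2 := fun i j hij => (hfr i j hij).1
  obtain ⟨T, hT, h0⟩ := exists_precompact_zero_mem_closure n (fun k => (f k).1)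
    (fun k => (hf k).2) fun d hd x => by
      -- Past the index `d`, the multiples `d • s k` are pairwise distinct.
      have hsub : {k | d • (f k).1 = x ∧ d ≤ k}.Subsingleton := by
        have key : ∀ i j, i < j → d ≤ j → d • (f i).1 ≠ d • (f j).1 := fun i j hij hdj =>
          (hfr i j hij).2 d (hdj.trans (hmono.le_apply)) hd
        rintro i ⟨hi, hdi⟩ j ⟨hj, hdj⟩
        rcases lt_trichotomy i j with h | h | h
        · exact (key i j h hdj (hi.trans hj.symm)).elim
        · exact h
        · exact (key j i h hdi (hj.trans hi.symm)).elim
      refine ((Set.finite_lt_nat d).union hsub.finite).subset fun k hk => ?_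
      rcases lt_or_ge k d with h | h
      · exact Or.inl h
      · exact Or.inr ⟨hk, h⟩
  have hgrp : @IsTopologicalAddGroup G T _ := hT.1.1
  have hcl : IsClosed ((z + ·) ⁻¹' X) := (hX T hT).preimage (continuous_const_add z)
  have := hcl.closure_subset_iff.2 (by rintro _ ⟨k, rfl⟩; exact (hf k).1) h0
  exact hzX (by simpa using this)

theorem IsClosedInEveryPrecompact.isFiniteUnionOfTorsionCosets {G : Type*} [AddCommGroup G]
    {X : Set G} (hX : IsClosedInEveryPrecompact X) : IsFiniteUnionOfTorsionCosets X := by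
  have h := hX.inter_torsionCoset 0 0
  have hu : (0 : G) +ᵥ {x : G | 0 • x = 0} = Set.univ :=
    Set.eq_univ_of_forall fun x => mem_torsionCoset.2 (by simp)
  rwa [hu, Set.inter_univ] at h

theorem isElementaryAlgebraic_torsionCoset {G : Type*} [AddCommGroup G] (a : G) (n : ℕ) :
    IsElementaryAlgebraic (a +ᵥ {x : G | n • x = 0}) := by
  rcases Nat.eq_zero_or_pos n with rfl | hn
  · refine ⟨2, 0, ![1, -1], two_pos, fun i => by fin_cases i <;> simp, Set.ext fun x => ?_⟩
    rw [mem_torsionCoset]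
    simp
  · refine ⟨n, fun _ => -a, 1, hn, fun i => Or.inr rfl, Set.ext fun x => ?_⟩
    rw [mem_torsionCoset]
    simp [← sub_eq_add_neg, smul_sub, sub_eq_zero]

theorem IsFiniteUnionOfTorsionCosets.isAlgebraicSet {G : Type*} [AddCommGroup G] {X : Set G}
    (hX : IsFiniteUnionOfTorsionCosets X) : IsAlgebraicSet X := by
  obtain ⟨S, hS, rfl⟩ := hX
  refine ⟨{⋃ p ∈ S, p.1 +ᵥ {x : G | p.2 • x = 0}}, ?_, (Set.sInter_singleton _).symm⟩
  rintro _ rfl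
  refine ⟨_, hS.image fun p => p.1 +ᵥ {x : G | p.2 • x = 0}, ?_, (Set.sUnion_image _ _).symm⟩
  rintro _ ⟨p, -, rfl⟩
  exact isElementaryAlgebraic_torsionCoset p.1 p.2

theorem IsAlgebraicSet.isUnconditionallyClosed {G : Type*} [AddGroup G] {X : Set G}
    (hX : IsAlgebraicSet X) : IsUnconditionallyClosed X := by
  rintro T ⟨hgrp, hT2⟩
  obtain ⟨𝓕, h𝓕, rfl⟩ := hX
  refine isClosed_sInter fun F hF => ?_
  obtain ⟨𝓔, hfin, h𝓔, rfl⟩ := h𝓕 F hF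
  rw [Set.sUnion_eq_biUnion]
  refine hfin.isClosed_biUnion fun E hE => ?_
  obtain ⟨n, a, ε, -, -, rfl⟩ := h𝓔 E hE
  refine isClosed_eq ?_ continuous_const
  simp_rw [List.ofFn_eq_map]
  refine continuous_list_sum _ fun i _ => ?_
  exact (continuous_zsmul (ε i)).add continuous_const

end MarkovZariski

theorem theoremA {G : Type*} [AddCommGroup G] :
    (MarkovZariski.zariskiTopology G = MarkovZariski.markovTopology G ∧
      MarkovZariski.markovTopology G = MarkovZariski.precompactMarkovTopology G) ∧
    ∀ X : Set G,
      (MarkovZariski.IsAlgebraicSet X ↔ MarkovZariski.IsFiniteUnionOfTorsionCosets X) ∧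
      (MarkovZariski.IsAlgebraicSet X ↔ MarkovZariski.IsUnconditionallyClosed X) ∧
      (MarkovZariski.IsAlgebraicSet X ↔ MarkovZariski.IsClosedInEveryPrecompact X) := by
  open MarkovZariski in
  have hac (X : Set G) : IsAlgebraicSet X → IsUnconditionallyClosed X :=
    IsAlgebraicSet.isUnconditionallyClosed
  have hcd (X : Set G) : IsUnconditionallyClosed X → IsClosedInEveryPrecompact X :=
    fun h T hT => h T hT.1
  have hdb (X : Set G) : IsClosedInEveryPrecompact X → IsFiniteUnionOfTorsionCosets X :=
    IsClosedInEveryPrecompact.isFiniteUnionOfTorsionCosets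
  have hba (X : Set G) : IsFiniteUnionOfTorsionCosets X → IsAlgebraicSet X :=
    IsFiniteUnionOfTorsionCosets.isAlgebraicSet
  have hZ (X : Set G) : IsClosed[zariskiTopology G] X ↔ IsAlgebraicSet X := by
    rw [← @isOpen_compl_iff]
    change IsAlgebraicSet Xᶜᶜ ↔ _
    rw [compl_compl]
  have hM (X : Set G) : IsClosed[markovTopology G] X ↔ IsUnconditionallyClosed X :=
    isClosed_sSup_iff
  have hP (X : Set G) : IsClosed[precompactMarkovTopology G] X ↔ IsClosedInEveryPrecompact X :=
    isClosed_sSup_iff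
  refine ⟨⟨?_, ?_⟩, fun X => ⟨⟨fun h => hdb X (hcd X (hac X h)), hba X⟩,
    ⟨hac X, fun h => hba X (hdb X (hcd X h))⟩,
    ⟨fun h => hcd X (hac X h), fun h => hba X (hdb X h)⟩⟩⟩
  · refine TopologicalSpace.ext_iff_isClosed.2 fun X => ?_
    rw [hZ, hM]
    exact ⟨hac X, fun h => hba X (hdb X (hcd X h))⟩
  · refine TopologicalSpace.ext_iff_isClosed.2 fun X => ?_
    rw [hM, hP]
    exact ⟨hcd X, fun h => hac X (hba X (hdb X h))⟩
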